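/- Let $I,J,K$ be finite sets ($I,J$ non-empty) and let $A^k\in\mathbb R^{I\times J}$, $k\in K$, be payoff matrices. For $p\in\Delta(K)$ put $A^p=\sum_{k}p_kA^k$. For $N\ge 1$ let $\Gamma_N(p)$ be the $N$-stage zero-sum repeated game with incomplete information on the side of Player 2: a state $k$ is drawn from the prior $p$ and told to Player 1 only; at each stage $n=1,\dots,N$ the players simultaneously choose actions $i_n\in I$, $j_n\in J$, with past actions publicly observed; Player 1 maximizes and Player 2 minimizes the expected total payoff $\mathbb E\big[\sum_{n=1}^N A^k_{i_n,j_n}\big]$ over behavioral strategies. This game has a value, denoted $V_N(p)$. For a probability measure $\mathcal P$ on $\Delta(K)$ let $\mathcal V_1(\mathcal P)$ be the value of the one-stage game in which $q\in\Delta(K)$ is drawn from $\mathcal P$ and told to Player 1 only, and then the matrix game $A^q$ is played. Suppose that the game is almost-fair, i.e. for every $p\in\Delta(K)$ the matrix game $A^p$ (in mixed strategies) has value $0$, and that Player 1 has small profitable revelations, i.e. there are $p',p''\in\Delta(K)$ with $p'\neq p''$ and a constant $C_A>0$ such that, with $p(\alpha)=\alpha p'+(1-\alpha)p''$, $$\mathcal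 V_1\left(\tfrac12\delta_{p(\alpha_1)}+\tfrac12\delta_{p(\alpha_2)}\right)\ \ge\ C_A\,|\alpha_1-\alpha_2|\qquad\text{for all }\alpha_1,\alpha_2\in[0,1].$$ Then $V_N(p)$ is of the order of $\sqrt N$ for every $p\in\Delta(K)$ with $p_k>0$ for all $k\in K$: there are constants $C_1,C_2>0$, which may depend on $p$ and on the game but not on $N$, such that $$C_1\sqrt N\ \le\ V_N(p)\ \le\ C_2\sqrt N\qquad\text{for all }N\ge 1.$$ -/

import Mathlib

open MeasureTheory

noncomputable section

/-- `v` is the value of the two-person zero-sum game in normal form with payoff `g` (the first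
player maximizes, the second one minimizes), and both players have optimal strategies. -/
def IsGameValue {S T : Type*} (g : S → T → ℝ) (v : ℝ) : Prop :=
  (∃ s, ∀ t, v ≤ g s t) ∧ (∃ t, ∀ s, g s t ≤ v)

/-- The maxmin `sup_s inf_t g s t` of a zero-sum game with bounded payoff function. It is the value
of the game whenever the game has a value (see `IsGameValue.gameValue_eq`). -/
def gameValue {S T : Type*} (g : S → T → ℝ) : ℝ :=
  ⨆ s, ⨅ t, g s t

theorem IsGameValue.gameValue_eq {S T : Type*} {g : S → T → ℝ} {v : ℝ} (h : IsGameValue g v)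
    (hg : ∀ s, BddBelow (Set.range (g s))) : gameValue g = v := by
  obtain ⟨⟨s₀, hs₀⟩, ⟨t₀, ht₀⟩⟩ := h
  have : Nonempty S := ⟨s₀⟩
  have : Nonempty T := ⟨t₀⟩
  have hle : ∀ s, ⨅ t, g s t ≤ v := fun s => (ciInf_le (hg s) t₀).trans (ht₀ s)
  apply le_antisymm
  · exact ciSup_le hle
  · exact (le_ciInf hs₀).trans (le_ciSup (f := fun s => ⨅ t, g s t) ⟨v, by rintro _ ⟨s, rfl⟩; exact hle s⟩ s₀)

namespace RepeatedGame

variable {I J K : Type*} [Fintype I] [Fintype J] [Fintype K]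

/-- The expected stage payoff matrix `A^p = ∑ₖ pₖ Aᵏ`. -/
def avgMatrix (A : K → Matrix I J ℝ) (p : stdSimplex ℝ K) : Matrix I J ℝ :=
  ∑ k, p k • A k

/-- The expected payoff `∑ᵢⱼ xᵢ Mᵢⱼ yⱼ` of mixed actions `x`, `y` in the matrix game `M`. -/
def mixedPayoff (M : Matrix I J ℝ) (x : stdSimplex ℝ I) (y : stdSimplex ℝ J) : ℝ :=
  ∑ i, ∑ j, x i * M i j * y j

/-- A behavioral strategy of the informed player: the distribution of the current action as a
function of the history of past actions (listed in chronological order) and of the state. In the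
`N`-stage game only its values on histories of length less than `N` matter. -/
abbrev Strategy₁ (I J K : Type*) [Fintype I] : Type _ :=
  List (I × J) → K → stdSimplex ℝ I

/-- A behavioral strategy of the uninformed player, who does not observe the state. -/
abbrev Strategy₂ (I J : Type*) [Fintype J] : Type _ :=
  List (I × J) → stdSimplex ℝ J

/-- The history of actions before stage `n` along the play `ω` (stages are numbered from `0`). -/
def history {N : ℕ} (ω : Fin N → I × J) (n : Fin N) : List (I × J) :=
  (List.ofFn ω).take n

/-- The conditional probability of the play `ω` of the `N`-stage game given the state `k`. -/
def playProb {N : ℕ} (σ : Strategy₁ I J K) (τ : Strategy₂ I J) (k : K) (ω : Fin N → I × J) : ℝ :=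
  ∏ n, σ (history ω n) k (ω n).1 * τ (history ω n) (ω n).2

/-- The expected total (not normalized) payoff of the `N`-stage game with prior `p`. -/
def totalPayoff (A : K → Matrix I J ℝ) (N : ℕ) (p : stdSimplex ℝ K)
    (σ : Strategy₁ I J K) (τ : Strategy₂ I J) : ℝ :=
  ∑ k, p k * ∑ ω : Fin N → I × J, playProb σ τ k ω * ∑ n, A k (ω n).1 (ω n).2

/-- The value `V_N(p)` of the `N`-stage game with prior `p`. -/
def value (A : K → Matrix I J ℝ) (N : ℕ) (p : stdSimplex ℝ K) : ℝ :=
  gameValue (totalPayoff A N p)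

/-- The game is almost-fair: the value `u(p)` of the non-revealing game, i.e. of the matrix game
`A^p` in mixed actions, is zero for every prior `p`. -/
def AlmostFair (A : K → Matrix I J ℝ) : Prop :=
  ∀ p : stdSimplex ℝ K, gameValue (mixedPayoff (avgMatrix A p)) = 0

/-- A strategy of the first player in the one-stage game with states `q ∈ Δ(K)`: a measurable choice
of a mixed action depending on the state. -/
abbrev BeliefStrategy (I K : Type*) [Fintype I] [Fintype K] : Type _ :=
  {x : stdSimplex ℝ K → stdSimplex ℝ I // Measurable x}

/-- Expected payoff in the one-stage game in which the state `q ∈ Δ(K)` is drawn from `P`, is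
observed by the first player only, and the stage payoff matrix is `A^q`. -/
def beliefPayoff (A : K → Matrix I J ℝ) (P : Measure (stdSimplex ℝ K))
    (x : BeliefStrategy I K) (y : stdSimplex ℝ J) : ℝ :=
  ∫ q, mixedPayoff (avgMatrix A q) (x.1 q) y ∂P

/-- The value `𝒱₁(P)` of the one-stage game with states in `Δ(K)` and prior `P`. -/
def beliefValue (A : K → Matrix I J ℝ) (P : Measure (stdSimplex ℝ K)) : ℝ :=
  gameValue (beliefPayoff A P)

/-- The point `p(α) = α p' + (1 - α) p''` of the segment `[p', p'']`. -/
def segmentPoint (p' p'' : stdSimplex ℝ K) (α : unitInterval) : stdSimplex ℝ K :=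
  ⟨(α : ℝ) • (p' : K → ℝ) + (1 - (α : ℝ)) • (p'' : K → ℝ),
    convex_stdSimplex ℝ K p'.2 p''.2 α.2.1 (sub_nonneg.2 α.2.2) (by ring)⟩

/-- The equal split `½ δ_q + ½ δ_{q'}`. -/
def equalSplit (q q' : stdSimplex ℝ K) : Measure (stdSimplex ℝ K) :=
  (1 / 2 : ENNReal) • Measure.dirac q + (1 / 2 : ENNReal) • Measure.dirac q'

/-- The informed player has small profitable revelations. -/
def HasSmallProfitableRevelations (A : K → Matrix I J ℝ) : Prop :=
  ∃ p' p'' : stdSimplex ℝ K, p' ≠ p'' ∧ ∃ C : ℝ, 0 < C ∧ ∀ α₁ α₂ : unitInterval,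
    C * |(α₁ : ℝ) - (α₂ : ℝ)| ≤
      beliefValue A (equalSplit (segmentPoint p' p'' α₁) (segmentPoint p' p'' α₂))

end RepeatedGame

end

/-! Priors are kept as unnormalized vectors `π`: after action `i` the prior becomes `π k * σ [] k
i`, so conditioning needs no division and `priorPayoff_succ` supports induction on the number of
stages.

Upper bound: since the value exists, it suffices to reply to one optimal strategy of Player 1, and
Player 2 may then track the belief. Playing optimally in the average matrix game at the current
belief, he loses in a stage at most a constant times the L¹ variation of the belief. Beliefs form a
bounded martingale, so their squared variation is bounded over the whole game, and Cauchy–Schwarz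
gives `√N` (`AlmostFair.exists_priorPayoff_le`).

Lower bound: Player 1 moves the belief along the segment as a random walk with steps of order
`1/√N`, each earning a comparable amount, hence `√N` in total
(`AlmostFair.guarantees_segmentPoint`). A prior of full support contains a multiple of the segment's
midpoint; on the remainder she guarantees 0. -/

/-! ### Minimax theorem for convexlike payoffs -/

/-- If no `t` holds every `s` down to `v`, compactness leaves finitely many `s` against which every
`t` fails. Separating the payoff vectors on these from the orthant below `v` yields weights, and the
corresponding mixture guarantees `v`. -/
theorem exists_guarantee_or_of_compact {S T : Type*} [TopologicalSpace T] [CompactSpace T]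
    [Nonempty T] {f : S → T → ℝ} (hf : ∀ s, Continuous (f s))
    (hS : ∀ s₁ s₂, ∀ a b : ℝ, 0 ≤ a → 0 ≤ b → a + b = 1 →
      ∃ s, ∀ t, a * f s₁ t + b * f s₂ t ≤ f s t)
    (hT : ∀ t₁ t₂, ∀ a b : ℝ, 0 ≤ a → 0 ≤ b → a + b = 1 →
      ∃ t, ∀ s, f s t ≤ a * f s t₁ + b * f s t₂) (v : ℝ) :
    (∃ t, ∀ s, f s t ≤ v) ∨ ∃ s, ∀ t, v ≤ f s t := by
  classical
  rw [or_iff_not_imp_left]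
  intro h
  push Not at h
  obtain ⟨F, hF⟩ := isCompact_univ.elim_finite_subcover (fun s => {t | v < f s t})
    (fun s => isOpen_lt continuous_const (hf s))
    (fun t _ => Set.mem_iUnion.2 (h t))
  have hcov : ∀ t, ∃ s : F, v < f s t := fun t => by
    obtain ⟨s, hs⟩ := Set.mem_iUnion.1 (hF (Set.mem_univ t))
    obtain ⟨hsF, hs⟩ := Set.mem_iUnion.1 hs
    exact ⟨⟨s, hsF⟩, hs⟩
  let X : Set (F → ℝ) := {z | ∃ t, ∀ s : F, f s t ≤ z s}
  let Y : Set (F → ℝ) := Set.univ.pi fun _ => Set.Iio v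
  have hX : Convex ℝ X := by
    rintro z₁ ⟨t₁, h₁⟩ z₂ ⟨t₂, h₂⟩ a b ha hb hab
    obtain ⟨t, ht⟩ := hT t₁ t₂ a b ha hb hab
    refine ⟨t, fun s => (ht s).trans ?_⟩
    simp only [Pi.add_apply, Pi.smul_apply, smul_eq_mul]
    gcongr
    exacts [h₁ s, h₂ s]
  have hY : Convex ℝ Y := convex_pi fun _ _ => convex_Iio v
  have hYo : IsOpen Y := isOpen_set_pi Set.finite_univ fun _ _ => isOpen_Iio
  have hdisj : Disjoint Y X := by
    rw [Set.disjoint_left]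
    rintro z hzY ⟨t, ht⟩
    obtain ⟨s, hs⟩ := hcov t
    exact absurd (hzY s trivial) (not_lt.2 (hs.le.trans (ht s)))
  obtain ⟨φ, u, hφY, hφX⟩ := geometric_hahn_banach_open hY hYo hX hdisj
  have hφ : ∀ z, φ z = ∑ s, z s * φ (Pi.single s 1) := fun z => by
    conv_lhs => rw [pi_eq_sum_univ' z]
    simp [map_sum]
  -- `X` is upward closed, so a negative coordinate of `φ` would make `φ` unbounded below on it.
  have hw : ∀ s, 0 ≤ φ (Pi.single s 1) := by
    intro s
    by_contra! hneg
    obtain ⟨t⟩ := ‹Nonempty T›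
    set z : F → ℝ := fun s => f s t
    obtain ⟨n, hn⟩ := exists_nat_gt ((φ z - u) / (-φ (Pi.single s 1)))
    rw [div_lt_iff₀ (by linarith)] at hn
    have := hφX (z + (n : ℝ) • Pi.single s 1) ⟨t, fun s' => by
      have : (0 : ℝ) ≤ (Pi.single s 1 : F → ℝ) s' := by
        by_cases hs : s' = s
        · subst hs; simp
        · simp [hs]
      simp only [Pi.add_apply, Pi.smul_apply, smul_eq_mul, z]
      nlinarith [mul_nonneg n.cast_nonneg this]⟩
    simp only [map_add, map_smul, smul_eq_mul] at this
    linarith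
  have hv : φ (fun _ => v) ≤ u := by
    have hlim : Filter.Tendsto (fun x : ℝ => φ (fun _ => x)) (nhdsWithin v (Set.Iio v))
        (nhds (φ fun _ => v)) :=
      ((φ.continuous.comp (continuous_pi fun _ => continuous_id)).tendsto v).mono_left
        nhdsWithin_le_nhds
    exact le_of_tendsto hlim (Filter.eventually_of_mem self_mem_nhdsWithin
      fun x hx => (hφY _ fun _ _ => hx).le)
  set W := ∑ s, φ (Pi.single s 1) with hWdef
  have hW : 0 < W := by
    refine (Finset.sum_nonneg fun s _ => hw s).lt_of_ne fun h0 => ?_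
    have hz : ∀ z, φ z = 0 := fun z => by
      have := (Finset.sum_eq_zero_iff_of_nonneg (fun s _ => hw s)).1 h0.symm
      rw [hφ z]
      exact Finset.sum_eq_zero fun s hs => by rw [this s hs, mul_zero]
    obtain ⟨t⟩ := ‹Nonempty T›
    have h1 := hφY (fun _ => v - 1) fun _ _ => by simp
    have h2 := hφX (fun s => f s t) ⟨t, fun _ => le_rfl⟩
    rw [hz] at h1 h2
    linarith
  -- Convexity of this set extends `hS` from two strategies to finite mixtures.
  let D : Set (T → ℝ) := {g | ∃ s, ∀ t, g t ≤ f s t}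
  have hD : Convex ℝ D := by
    rintro z₁ ⟨s₁, h₁⟩ z₂ ⟨s₂, h₂⟩ a b ha hb hab
    obtain ⟨s, hs⟩ := hS s₁ s₂ a b ha hb hab
    refine ⟨s, fun t => le_trans ?_ (hs t)⟩
    simp only [Pi.add_apply, Pi.smul_apply, smul_eq_mul]
    gcongr
    exacts [h₁ t, h₂ t]
  obtain ⟨s, hs⟩ := hD.sum_mem (t := Finset.univ) (w := fun s => φ (Pi.single s 1) / W)
    (z := fun s : F => f s) (fun s _ => div_nonneg (hw s) hW.le)
    (by rw [← Finset.sum_div, div_self hW.ne']) (fun s _ => ⟨s, fun _ => le_rfl⟩)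
  refine ⟨s, fun t => le_trans ?_ (hs t)⟩
  have h1 := hv.trans (hφX (fun s => f s t) ⟨t, fun _ => le_rfl⟩)
  rw [hφ, hφ (fun s => f s t), ← Finset.mul_sum] at h1
  simp only [Finset.sum_apply, Pi.smul_apply, smul_eq_mul]
  calc v ≤ (∑ s : F, f s t * φ (Pi.single s 1)) / W := (le_div_iff₀ hW).2 h1
    _ = _ := by rw [Finset.sum_div]; exact Finset.sum_congr rfl fun s _ => by ring

/-- Minimax theorem for convexlike continuous payoffs on compact strategy spaces. -/
theorem exists_isGameValue {S T : Type*} [TopologicalSpace S] [CompactSpace S] [Nonempty S]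
    [TopologicalSpace T] [CompactSpace T] [Nonempty T] {f : S → T → ℝ}
    (hfS : ∀ t, Continuous fun s => f s t) (hfT : ∀ s, Continuous (f s))
    (hS : ∀ s₁ s₂, ∀ a b : ℝ, 0 ≤ a → 0 ≤ b → a + b = 1 →
      ∃ s, ∀ t, a * f s₁ t + b * f s₂ t ≤ f s t)
    (hT : ∀ t₁ t₂, ∀ a b : ℝ, 0 ≤ a → 0 ≤ b → a + b = 1 →
      ∃ t, ∀ s, f s t ≤ a * f s t₁ + b * f s t₂) :
    ∃ v, IsGameValue f v := by
  let E : Set ℝ := {v | ∃ s, ∀ t, v ≤ f s t}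
  let E' : Set ℝ := {v | ∃ t, ∀ s, f s t ≤ v}
  have hE : IsClosed E := by
    have : IsClosed {x : S × ℝ | ∀ t, x.2 ≤ f x.1 t} := by
      simp only [Set.ofPred_forall]
      exact isClosed_iInter fun t => isClosed_le continuous_snd ((hfS t).comp continuous_fst)
    convert isClosedMap_snd_of_compactSpace _ this
    ext v
    simp [E]
  have hE' : IsClosed E' := by
    have : IsClosed {x : T × ℝ | ∀ s, f s x.1 ≤ x.2} := by
      simp only [Set.ofPred_forall]
      exact isClosed_iInter fun s => isClosed_le ((hfT s).comp continuous_fst) continuous_snd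
    convert isClosedMap_snd_of_compactSpace _ this
    ext v
    simp [E']
  obtain ⟨s₀⟩ := ‹Nonempty S›
  obtain ⟨t₀⟩ := ‹Nonempty T›
  obtain ⟨b, hb⟩ := (isCompact_range (hfT s₀)).bddBelow
  obtain ⟨B, hB⟩ := (isCompact_range (hfS t₀)).bddAbove
  have hne : E.Nonempty := ⟨b, s₀, fun t => hb ⟨t, rfl⟩⟩
  have hbdd : BddAbove E := ⟨B, fun v ⟨s, hs⟩ => (hs t₀).trans (hB ⟨s, rfl⟩)⟩
  have : Nonempty T := ⟨t₀⟩
  refine ⟨sSup E, hE.csSup_mem hne hbdd, ?_⟩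
  -- Levels above `sSup E` are out of reach for the first player, so the second can enforce each of
  -- them; closedness of `E'` then includes `sSup E` itself.
  have hIoi : Set.Ioi (sSup E) ⊆ E' := fun v hv =>
    (exists_guarantee_or_of_compact hfT hS hT v).resolve_right
      fun h => absurd (le_csSup hbdd h) (not_le.2 hv)
  exact hE'.closure_subset_iff.2 hIoi (by rw [closure_Ioi]; exact Set.self_mem_Ici)

namespace RepeatedGame

set_option linter.unusedSectionVars false

variable {I J K : Type*} [Fintype I] [Fintype J] [Fintype K]

/-! ### Recursive structure of the repeated game -/

/-- The strategy that prescribes `y` at the first stage and continues with `c a` after `a`. -/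
def branch {X Y : Type*} (y : Y) (c : X → List X → Y) : List X → Y
  | [] => y
  | a :: h => c a h

/-- The continuation of a strategy after the first outcome `a`. -/
def tail {X Y : Type*} (s : List X → Y) (a : X) : List X → Y := fun h => s (a :: h)

@[simp] theorem branch_nil {X Y : Type*} (y : Y) (c : X → List X → Y) : branch y c [] = y := rfl

@[simp] theorem tail_branch {X Y : Type*} (y : Y) (c : X → List X → Y) (a : X) :
    tail (branch y c) a = c a := rfl

theorem history_cons_zero {N : ℕ} (a : I × J) (ω : Fin N → I × J) :
    history (Fin.cons a ω : Fin (N + 1) → I × J) 0 = [] := by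
  simp [history]

theorem history_cons_succ {N : ℕ} (a : I × J) (ω : Fin N → I × J) (n : Fin N) :
    history (Fin.cons a ω : Fin (N + 1) → I × J) n.succ = a :: history ω n := by
  simp [history, List.ofFn_succ]

theorem playProb_cons {N : ℕ} (σ : Strategy₁ I J K) (τ : Strategy₂ I J) (k : K) (a : I × J)
    (ω : Fin N → I × J) :
    playProb σ τ k (Fin.cons a ω : Fin (N + 1) → I × J) =
      σ [] k a.1 * τ [] a.2 * playProb (tail σ a) (tail τ a) k ω := by
  simp only [playProb, Fin.prod_univ_succ, history_cons_zero, history_cons_succ, Fin.cons_zero,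
    Fin.cons_succ, tail]

theorem sum_cons {N : ℕ} {X : Type*} [Fintype X] (f : (Fin (N + 1) → X) → ℝ) :
    ∑ ω, f ω = ∑ a, ∑ ω : Fin N → X, f (Fin.cons a ω) := by
  rw [← Fintype.sum_prod_type']
  exact (Fintype.sum_equiv (Fin.consEquiv fun _ => X) _ _ fun _ => rfl).symm

theorem sum_playProb (N : ℕ) (σ : Strategy₁ I J K) (τ : Strategy₂ I J) (k : K) :
    ∑ ω : Fin N → I × J, playProb σ τ k ω = 1 := by
  induction N generalizing σ τ with
  | zero => simp [playProb]
  | succ N ih =>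
    simp only [sum_cons, playProb_cons, ← Finset.mul_sum, ih, mul_one, Fintype.sum_prod_type]
    simp [stdSimplex.sum_eq_one]

/-- The expected total payoff in state `k`. -/
def statePayoff (A : K → Matrix I J ℝ) (N : ℕ) (k : K)
    (σ : Strategy₁ I J K) (τ : Strategy₂ I J) : ℝ :=
  ∑ ω : Fin N → I × J, playProb σ τ k ω * ∑ n, A k (ω n).1 (ω n).2

/-- The total payoff for a prior given by an arbitrary, not normalized, vector. -/
def priorPayoff (A : K → Matrix I J ℝ) (N : ℕ) (π : K → ℝ)
    (σ : Strategy₁ I J K) (τ : Strategy₂ I J) : ℝ :=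
  ∑ k, π k * statePayoff A N k σ τ

theorem totalPayoff_eq_priorPayoff (A : K → Matrix I J ℝ) (N : ℕ) (p : stdSimplex ℝ K)
    (σ : Strategy₁ I J K) (τ : Strategy₂ I J) :
    totalPayoff A N p σ τ = priorPayoff A N p σ τ := rfl

theorem statePayoff_succ (A : K → Matrix I J ℝ) (N : ℕ) (k : K)
    (σ : Strategy₁ I J K) (τ : Strategy₂ I J) :
    statePayoff A (N + 1) k σ τ = ∑ i, ∑ j, σ [] k i * τ [] j *
      (A k i j + statePayoff A N k (tail σ (i, j)) (tail τ (i, j))) := by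
  simp only [statePayoff, sum_cons, playProb_cons, Fin.sum_univ_succ, Fin.cons_zero, Fin.cons_succ,
    Fintype.sum_prod_type]
  refine Finset.sum_congr rfl fun i _ => Finset.sum_congr rfl fun j _ => ?_
  simp only [mul_add, Finset.sum_add_distrib, ← Finset.sum_mul, ← Finset.mul_sum, sum_playProb,
    one_mul, mul_assoc]

@[simp] theorem priorPayoff_zero_stages (A : K → Matrix I J ℝ) (π : K → ℝ)
    (σ : Strategy₁ I J K) (τ : Strategy₂ I J) : priorPayoff A 0 π σ τ = 0 := by
  simp [priorPayoff, statePayoff]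

theorem priorPayoff_succ (A : K → Matrix I J ℝ) (N : ℕ) (π : K → ℝ)
    (σ : Strategy₁ I J K) (τ : Strategy₂ I J) :
    priorPayoff A (N + 1) π σ τ = ∑ i, ∑ j, τ [] j * (∑ k, π k * σ [] k i * A k i j +
      priorPayoff A N (fun k => π k * σ [] k i) (tail σ (i, j)) (tail τ (i, j))) := by
  simp only [priorPayoff, statePayoff_succ, Finset.mul_sum, ← Finset.sum_add_distrib]
  rw [Finset.sum_comm]
  refine Finset.sum_congr rfl fun i _ => ?_
  rw [Finset.sum_comm]
  exact Finset.sum_congr rfl fun j _ => Finset.sum_congr rfl fun k _ => by ring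

theorem priorPayoff_smul (A : K → Matrix I J ℝ) (N : ℕ) (c : ℝ) (π : K → ℝ)
    (σ : Strategy₁ I J K) (τ : Strategy₂ I J) :
    priorPayoff A N (c • π) σ τ = c * priorPayoff A N π σ τ := by
  simp only [priorPayoff, Finset.mul_sum, Pi.smul_apply, smul_eq_mul, mul_assoc]

/-- Families of nonnegative weights with a given sum are obtained from mixed actions. -/
theorem exists_stdSimplex_mul_eq [Nonempty I] {c : ℝ} {w : I → ℝ} (hw : ∀ i, 0 ≤ w i)
    (hc : ∑ i, w i = c) : ∃ x : stdSimplex ℝ I, ∀ i, c * x i = w i := by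
  have hc0 : 0 ≤ c := hc ▸ Finset.sum_nonneg fun i _ => hw i
  rcases hc0.eq_or_lt with h | h
  · subst h
    refine ⟨Classical.arbitrary _, fun i => ?_⟩
    rw [(Finset.sum_eq_zero_iff_of_nonneg fun i _ => hw i).1 hc i (Finset.mem_univ i), zero_mul]
  · refine ⟨⟨fun i => w i / c, fun i => div_nonneg (hw i) hc0, ?_⟩, fun i => ?_⟩
    · rw [← Finset.sum_div, hc, div_self h.ne']
    · exact mul_div_cancel₀ _ h.ne'

/-- The informed player can play one of two strategies according to a lottery that depends on
the state. -/
theorem exists_priorPayoff_add [Nonempty I] (A : K → Matrix I J ℝ) (N : ℕ) {π₁ π₂ : K → ℝ}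
    (h₁ : 0 ≤ π₁) (h₂ : 0 ≤ π₂) (σ₁ σ₂ : Strategy₁ I J K) :
    ∃ σ : Strategy₁ I J K, ∀ τ : Strategy₂ I J,
      priorPayoff A N (π₁ + π₂) σ τ = priorPayoff A N π₁ σ₁ τ + priorPayoff A N π₂ σ₂ τ := by
  induction N generalizing π₁ π₂ σ₁ σ₂ with
  | zero => exact ⟨σ₁, by simp⟩
  | succ N ih =>
    have hn₁ : ∀ i, 0 ≤ fun k => π₁ k * σ₁ [] k i :=
      fun i k => mul_nonneg (h₁ k) (stdSimplex.zero_le _ _)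
    have hn₂ : ∀ i, 0 ≤ fun k => π₂ k * σ₂ [] k i :=
      fun i k => mul_nonneg (h₂ k) (stdSimplex.zero_le _ _)
    choose x hx using fun k => exists_stdSimplex_mul_eq (c := (π₁ + π₂) k)
      (w := fun i => π₁ k * σ₁ [] k i + π₂ k * σ₂ [] k i)
      (fun i => add_nonneg (hn₁ i k) (hn₂ i k))
      (by simp [Finset.sum_add_distrib, ← Finset.mul_sum, stdSimplex.sum_eq_one])
    -- The action does not reveal the outcome of the lottery; its weights, multiplied by the
    -- likelihoods of the action, are carried into the continuation.
    choose c hc using fun a : I × J =>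
      ih (hn₁ a.1) (hn₂ a.1) (tail σ₁ a) (tail σ₂ a)
    refine ⟨branch x c, fun τ => ?_⟩
    simp only [priorPayoff_succ, branch_nil, tail_branch, hx, ← Finset.sum_add_distrib]
    refine Finset.sum_congr rfl fun i _ => Finset.sum_congr rfl fun j _ => ?_
    have := hc (i, j) (tail τ (i, j))
    simp only [Pi.add_def] at this
    rw [this]
    simp only [add_mul, Finset.sum_add_distrib]
    ring

/-- The uninformed player can play one of two strategies according to a lottery. -/
theorem exists_mul_priorPayoff_eq [Nonempty J] (A : K → Matrix I J ℝ) (N : ℕ) {a b : ℝ}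
    (ha : 0 ≤ a) (hb : 0 ≤ b) (τ₁ τ₂ : Strategy₂ I J) :
    ∃ τ : Strategy₂ I J, ∀ π (σ : Strategy₁ I J K),
      (a + b) * priorPayoff A N π σ τ =
        a * priorPayoff A N π σ τ₁ + b * priorPayoff A N π σ τ₂ := by
  induction N generalizing a b τ₁ τ₂ with
  | zero => exact ⟨τ₁, by simp⟩
  | succ N ih =>
    have hn₁ : ∀ j, 0 ≤ a * τ₁ [] j := fun j => mul_nonneg ha (stdSimplex.zero_le _ _)
    have hn₂ : ∀ j, 0 ≤ b * τ₂ [] j := fun j => mul_nonneg hb (stdSimplex.zero_le _ _)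
    obtain ⟨y, hy⟩ := exists_stdSimplex_mul_eq (c := a + b)
      (w := fun j => a * τ₁ [] j + b * τ₂ [] j)
      (fun j => add_nonneg (hn₁ j) (hn₂ j))
      (by simp [Finset.sum_add_distrib, ← Finset.mul_sum, stdSimplex.sum_eq_one])
    choose c hc using fun a : I × J =>
      ih (hn₁ a.2) (hn₂ a.2) (tail τ₁ a) (tail τ₂ a)
    refine ⟨branch y c, fun π σ => ?_⟩
    simp only [priorPayoff_succ, branch_nil, tail_branch, Finset.mul_sum,
      ← Finset.sum_add_distrib]
    refine Finset.sum_congr rfl fun i _ => Finset.sum_congr rfl fun j _ => ?_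
    rw [← mul_assoc, hy, mul_add, hc (i, j)]
    ring

/-! ### Existence of values -/

theorem continuous_stdSimplex_apply {X : Type*} [Fintype X] (x : X) :
    Continuous fun p : stdSimplex ℝ X => p x :=
  (continuous_apply x).comp continuous_subtype_val

theorem continuous_totalPayoff_left (A : K → Matrix I J ℝ) (N : ℕ) (p : stdSimplex ℝ K)
    (τ : Strategy₂ I J) : Continuous fun σ : Strategy₁ I J K => totalPayoff A N p σ τ := by
  have h : ∀ h k i, Continuous fun σ : Strategy₁ I J K => σ h k i := fun h k i =>
    (continuous_stdSimplex_apply i).comp ((continuous_apply k).comp (continuous_apply h))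
  exact continuous_finsetSum _ fun k _ => continuous_const.mul <|
    continuous_finsetSum _ fun ω _ => Continuous.mul
      (continuous_finsetProd _ fun n _ => (h _ _ _).mul continuous_const) continuous_const

theorem continuous_totalPayoff_right (A : K → Matrix I J ℝ) (N : ℕ) (p : stdSimplex ℝ K)
    (σ : Strategy₁ I J K) : Continuous (totalPayoff A N p σ) := by
  have h : ∀ h j, Continuous fun τ : Strategy₂ I J => τ h j := fun h j =>
    (continuous_stdSimplex_apply j).comp (continuous_apply h)
  exact continuous_finsetSum _ fun k _ => continuous_const.mul <|
    continuous_finsetSum _ fun ω _ => Continuous.mul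
      (continuous_finsetProd _ fun n _ => continuous_const.mul (h _ _)) continuous_const

/-- Behavioral strategies form a compact product of simplices. The payoff is not bilinear in them,
but lotteries over strategies have behavioral equivalents, which is the convexlikeness that minimax
requires. -/
theorem exists_isGameValue_totalPayoff [Nonempty I] [Nonempty J] (A : K → Matrix I J ℝ) (N : ℕ)
    (p : stdSimplex ℝ K) : ∃ v, IsGameValue (totalPayoff A N p) v := by
  refine exists_isGameValue (continuous_totalPayoff_left A N p)
    (continuous_totalPayoff_right A N p) (fun σ₁ σ₂ a b ha hb hab => ?_)
    (fun τ₁ τ₂ a b ha hb hab => ?_)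
  · have hp : (0 : K → ℝ) ≤ p := fun k => stdSimplex.zero_le p k
    obtain ⟨σ, hσ⟩ := exists_priorPayoff_add A N (smul_nonneg ha hp) (smul_nonneg hb hp) σ₁ σ₂
    rw [← add_smul, hab, one_smul] at hσ
    refine ⟨σ, fun τ => ?_⟩
    simp only [totalPayoff_eq_priorPayoff, hσ, priorPayoff_smul, le_refl]
  · obtain ⟨τ, hτ⟩ := exists_mul_priorPayoff_eq (K := K) A N ha hb τ₁ τ₂
    refine ⟨τ, fun σ => ?_⟩
    simp only [totalPayoff_eq_priorPayoff, ← hτ, hab, one_mul, le_refl]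

theorem isGameValue_value [Nonempty I] [Nonempty J] (A : K → Matrix I J ℝ) (N : ℕ)
    (p : stdSimplex ℝ K) : IsGameValue (totalPayoff A N p) (value A N p) := by
  obtain ⟨v, hv⟩ := exists_isGameValue_totalPayoff A N p
  rwa [value, hv.gameValue_eq fun σ =>
    (isCompact_range (continuous_totalPayoff_right A N p σ)).bddBelow]

theorem exists_stdSimplex_combo {X : Type*} [Fintype X] (x₁ x₂ : stdSimplex ℝ X) {a b : ℝ}
    (ha : 0 ≤ a) (hb : 0 ≤ b) (hab : a + b = 1) :
    ∃ x : stdSimplex ℝ X, ∀ k, x k = a * x₁ k + b * x₂ k :=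
  ⟨⟨_, convex_stdSimplex ℝ _ x₁.2 x₂.2 ha hb hab⟩, fun _ => rfl⟩

theorem continuous_mixedPayoff_left (M : Matrix I J ℝ) (y : stdSimplex ℝ J) :
    Continuous fun x => mixedPayoff M x y :=
  continuous_finsetSum _ fun i _ => continuous_finsetSum _ fun _ _ =>
    ((continuous_stdSimplex_apply i).mul continuous_const).mul continuous_const

theorem continuous_mixedPayoff_right (M : Matrix I J ℝ) (x : stdSimplex ℝ I) :
    Continuous (mixedPayoff M x) :=
  continuous_finsetSum _ fun _ _ => continuous_finsetSum _ fun j _ =>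
    continuous_const.mul (continuous_stdSimplex_apply j)

theorem exists_isGameValue_mixedPayoff [Nonempty I] [Nonempty J] (M : Matrix I J ℝ) :
    ∃ v, IsGameValue (mixedPayoff M) v := by
  refine exists_isGameValue (continuous_mixedPayoff_left M) (continuous_mixedPayoff_right M)
    (fun x₁ x₂ a b ha hb hab => ?_) (fun y₁ y₂ a b ha hb hab => ?_)
  · obtain ⟨x, hx⟩ := exists_stdSimplex_combo x₁ x₂ ha hb hab
    refine ⟨x, fun y => le_of_eq ?_⟩
    simp only [mixedPayoff, Finset.mul_sum, ← Finset.sum_add_distrib, hx]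
    exact Finset.sum_congr rfl fun i _ => Finset.sum_congr rfl fun j _ => by ring
  · obtain ⟨y, hy⟩ := exists_stdSimplex_combo y₁ y₂ ha hb hab
    refine ⟨y, fun x => le_of_eq ?_⟩
    simp only [mixedPayoff, Finset.mul_sum, ← Finset.sum_add_distrib, hy]
    exact Finset.sum_congr rfl fun i _ => Finset.sum_congr rfl fun j _ => by ring

theorem AlmostFair.isGameValue [Nonempty I] [Nonempty J] {A : K → Matrix I J ℝ}
    (hA : AlmostFair A) (p : stdSimplex ℝ K) : IsGameValue (mixedPayoff (avgMatrix A p)) 0 := by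
  obtain ⟨v, hv⟩ := exists_isGameValue_mixedPayoff (avgMatrix A p)
  rwa [← hA p, hv.gameValue_eq fun x =>
    (isCompact_range (continuous_mixedPayoff_right _ x)).bddBelow]

theorem mixedPayoff_avgMatrix (A : K → Matrix I J ℝ) (p : stdSimplex ℝ K)
    (x : stdSimplex ℝ I) (y : stdSimplex ℝ J) :
    mixedPayoff (avgMatrix A p) x y = ∑ i, ∑ j, y j * ∑ k, p k * x i * A k i j := by
  simp only [mixedPayoff, avgMatrix, Matrix.sum_apply, Matrix.smul_apply, smul_eq_mul,
    Finset.mul_sum, Finset.sum_mul]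
  exact Finset.sum_congr rfl fun i _ => Finset.sum_congr rfl fun j _ =>
    Finset.sum_congr rfl fun k _ => by ring

theorem exists_smul_stdSimplex [Nonempty K] {π : K → ℝ} (hπ : 0 ≤ π) :
    ∃ p : stdSimplex ℝ K, ∀ k, π k = (∑ k, π k) * p k := by
  obtain ⟨p, hp⟩ := exists_stdSimplex_mul_eq (w := π) hπ rfl
  exact ⟨p, fun k => (hp k).symm⟩

theorem AlmostFair.exists_nonneg [Nonempty I] [Nonempty J] [Nonempty K] {A : K → Matrix I J ℝ}
    (hA : AlmostFair A) {π : K → ℝ} (hπ : 0 ≤ π) :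
    ∃ x : stdSimplex ℝ I, ∀ y : stdSimplex ℝ J,
      0 ≤ ∑ i, ∑ j, y j * ∑ k, π k * x i * A k i j := by
  obtain ⟨p, hp⟩ := exists_smul_stdSimplex hπ
  obtain ⟨x, hx⟩ := (hA.isGameValue p).1
  refine ⟨x, fun y => ?_⟩
  have := mul_nonneg (Finset.sum_nonneg fun k _ => hπ k : 0 ≤ ∑ k, π k) (hx y)
  rw [mixedPayoff_avgMatrix] at this
  refine this.trans_eq ?_
  simp only [Finset.mul_sum]
  refine Finset.sum_congr rfl fun i _ => Finset.sum_congr rfl fun j _ =>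
    Finset.sum_congr rfl fun k _ => ?_
  rw [hp k]
  ring

theorem AlmostFair.exists_nonpos [Nonempty I] [Nonempty J] [Nonempty K] {A : K → Matrix I J ℝ}
    (hA : AlmostFair A) {π : K → ℝ} (hπ : 0 ≤ π) :
    ∃ y : stdSimplex ℝ J, ∀ i, ∑ k, π k * ∑ j, y j * A k i j ≤ 0 := by
  classical
  obtain ⟨p, hp⟩ := exists_smul_stdSimplex hπ
  obtain ⟨y, hy⟩ := (hA.isGameValue p).2
  refine ⟨y, fun i => ?_⟩
  have := mul_nonpos_of_nonneg_of_nonpos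
    (Finset.sum_nonneg fun k _ => hπ k : 0 ≤ ∑ k, π k) (hy ⟨_, single_mem_stdSimplex ℝ i⟩)
  refine le_of_eq_of_le ?_ this
  have hx : ∀ i', (⟨_, single_mem_stdSimplex ℝ i⟩ : stdSimplex ℝ I) i' =
    (Pi.single i 1 : I → ℝ) i' := fun _ => rfl
  simp only [mixedPayoff_avgMatrix, hx]
  rw [Finset.sum_eq_single i (fun i' _ h => by simp [h]) (by simp)]
  simp only [Pi.single_eq_same, mul_one, Finset.mul_sum]
  rw [Finset.sum_comm]
  refine Finset.sum_congr rfl fun j _ => Finset.sum_congr rfl fun k _ => ?_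
  rw [hp k]
  ring

/-! ### Upper bound -/

/-- AM–GM for `d = m - t / s * π`: `|d| ≤ ε t / 2 + d² / (2 ε t)`. The square is expanded so that `m
^ 2 / t` cancels against the potential of the continuation. -/
theorem abs_sub_le_of_le {ε m t : ℝ} (hε : 0 < ε) (hm : 0 ≤ m) (hmt : m ≤ t) (π s : ℝ) :
    |m - t / s * π| ≤
      ε / 2 * t + (m ^ 2 / t - 2 * m * (π / s) + t * (π / s) ^ 2) / (2 * ε) := by
  rcases (hm.trans hmt).eq_or_lt with rfl | ht
  · obtain rfl : m = 0 := le_antisymm hmt hm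
    simp
  · set d := m - t / s * π with hd
    have h : m ^ 2 / t - 2 * m * (π / s) + t * (π / s) ^ 2 = d ^ 2 / t := by
      rw [hd]
      generalize hr : π / s = r
      rw [show t / s * π = t * r by rw [← hr]; ring]
      field_simp
      ring
    rw [h, ← sq_abs d]
    have h2 : ε / 2 * t + |d| ^ 2 / t / (2 * ε) - |d| = (|d| - ε * t) ^ 2 / (2 * ε * t) := by
      field_simp
      ring
    have h3 : 0 ≤ (|d| - ε * t) ^ 2 / (2 * ε * t) := by positivity
    linarith

/-- Against a given strategy of the informed player, a myopic best reply to the current belief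
bounds the payoff by the variation of the beliefs. -/
theorem AlmostFair.exists_priorPayoff_le [Nonempty I] [Nonempty J] [Nonempty K]
    {A : K → Matrix I J ℝ} (hA : AlmostFair A) {c ε : ℝ} (hc : ∀ k i j, |A k i j| ≤ c)
    (hε : 0 < ε) (N : ℕ) {π : K → ℝ} (hπ : 0 ≤ π) (σ : Strategy₁ I J K) :
    ∃ τ : Strategy₂ I J, priorPayoff A N π σ τ ≤
      c * ∑ k, (N * (ε / 2) * ∑ l, π l + (∑ l, π l - π k ^ 2 / ∑ l, π l) / (2 * ε)) := by
  have hc0 : 0 ≤ c := by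
    obtain ⟨k⟩ := ‹Nonempty K›
    obtain ⟨i⟩ := ‹Nonempty I›
    obtain ⟨j⟩ := ‹Nonempty J›
    exact (abs_nonneg _).trans (hc k i j)
  induction N generalizing π σ with
  | zero =>
    refine ⟨fun _ => Classical.arbitrary _, ?_⟩
    rw [priorPayoff_zero_stages]
    refine mul_nonneg hc0 (Finset.sum_nonneg fun k _ => ?_)
    have hk : π k ≤ ∑ l, π l := Finset.single_le_sum (fun l _ => hπ l) (Finset.mem_univ k)
    have hs : 0 ≤ ∑ l, π l := (hπ k).trans hk
    have : π k ^ 2 / ∑ l, π l ≤ ∑ l, π l :=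
      div_le_of_le_mul₀ hs hs (by rw [sq]; exact mul_self_le_mul_self (hπ k) hk)
    simp only [Nat.cast_zero, zero_mul, zero_add]
    exact div_nonneg (sub_nonneg.2 this) (by linarith)
  | succ N ih =>
    set s := ∑ l, π l with hs
    set m : I → K → ℝ := fun i k => π k * σ [] k i with hm
    have hm0 : ∀ i, 0 ≤ m i := fun i k => mul_nonneg (hπ k) (stdSimplex.zero_le _ _)
    have hmk : ∀ k, ∑ i, m i k = π k := fun k => by
      simp only [hm, ← Finset.mul_sum, stdSimplex.sum_eq_one, mul_one]
    set t : I → ℝ := fun i => ∑ l, m i l with ht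
    have hts : ∑ i, t i = s := by
      simp only [ht]
      rw [Finset.sum_comm]
      simp only [hmk, hs]
    have ht0 : ∀ i, 0 ≤ t i := fun i => Finset.sum_nonneg fun k _ => hm0 i k
    have hmt : ∀ i k, m i k ≤ t i := fun i k =>
      Finset.single_le_sum (fun l _ => hm0 i l) (Finset.mem_univ k)
    have hs0 : 0 ≤ s := hts ▸ Finset.sum_nonneg fun i _ => ht0 i
    obtain ⟨y, hy⟩ := hA.exists_nonpos hπ
    choose τ hτ using fun a : I × J => ih (hm0 a.1) (tail σ a)
    refine ⟨branch y τ, ?_⟩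
    have hB : ∀ k i, |∑ j, y j * A k i j| ≤ c := fun k i => by
      calc |∑ j, y j * A k i j| ≤ ∑ j, |y j * A k i j| := Finset.abs_sum_le_sum_abs _ _
        _ ≤ ∑ j, y j * c := Finset.sum_le_sum fun j _ => by
          rw [abs_mul, abs_of_nonneg (stdSimplex.zero_le y j)]
          exact mul_le_mul_of_nonneg_left (hc k i j) (stdSimplex.zero_le y j)
        _ = c := by rw [← Finset.sum_mul, stdSimplex.sum_eq_one, one_mul]
    -- Were the belief unchanged by `i`, `m i` would be `t i / s` times `π`, and `y` would keep the
    -- payoff nonpositive; only the deviation costs.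
    have hstage : ∀ i, ∑ j, y j * ∑ k, m i k * A k i j ≤
        c * ∑ k, |m i k - t i / s * π k| := fun i => by
      have h1 : ∑ j, y j * ∑ k, m i k * A k i j =
          ∑ k, (m i k - t i / s * π k) * ∑ j, y j * A k i j +
            t i / s * ∑ k, π k * ∑ j, y j * A k i j := by
        rw [Finset.mul_sum, ← Finset.sum_add_distrib]
        simp only [Finset.mul_sum, ← Finset.sum_add_distrib]
        rw [Finset.sum_comm]
        exact Finset.sum_congr rfl fun k _ => Finset.sum_congr rfl fun j _ => by ring
      have h2 := mul_nonpos_of_nonneg_of_nonpos (div_nonneg (ht0 i) hs0) (hy i)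
      have h3 : ∑ k, (m i k - t i / s * π k) * ∑ j, y j * A k i j ≤
          c * ∑ k, |m i k - t i / s * π k| := by
        rw [Finset.mul_sum]
        refine Finset.sum_le_sum fun k _ => (le_abs_self _).trans ?_
        rw [abs_mul, mul_comm]
        exact mul_le_mul_of_nonneg_right (hB k i) (abs_nonneg _)
      linarith
    have hsplit : priorPayoff A (N + 1) π σ (branch y τ) ≤ ∑ i,
        (c * ∑ k, |m i k - t i / s * π k| +
          c * ∑ k, (N * (ε / 2) * t i + (t i - m i k ^ 2 / t i) / (2 * ε))) := by
      rw [priorPayoff_succ]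
      refine Finset.sum_le_sum fun i _ => ?_
      simp only [branch_nil, tail_branch, mul_add, Finset.sum_add_distrib]
      refine add_le_add (hstage i) ?_
      rw [← mul_add, ← Finset.sum_add_distrib]
      calc _ ≤ ∑ j, y j *
              (c * ∑ k, (N * (ε / 2) * t i + (t i - m i k ^ 2 / t i) / (2 * ε))) :=
            Finset.sum_le_sum fun j _ =>
              mul_le_mul_of_nonneg_left (hτ (i, j)) (stdSimplex.zero_le y j)
        _ = _ := by rw [← Finset.sum_mul, stdSimplex.sum_eq_one, one_mul]
    refine hsplit.trans ?_
    simp only [← mul_add, ← Finset.mul_sum, ← Finset.sum_add_distrib]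
    refine mul_le_mul_of_nonneg_left ?_ hc0
    rw [Finset.sum_comm]
    refine Finset.sum_le_sum fun k _ => ?_
    calc _ ≤ ∑ i, (((N + 1) * (ε / 2)) * t i + (1 / (2 * ε)) * t i
              - (π k / s / ε) * m i k + ((π k / s) ^ 2 / (2 * ε)) * t i) := by
          refine Finset.sum_le_sum fun i _ => ?_
          have := abs_sub_le_of_le hε (hm0 i k) (hmt i k) (π k) s
          refine (add_le_add_left this _).trans (le_of_eq ?_)
          generalize m i k ^ 2 / t i = w
          field_simp
          ring
      _ = _ := by
        -- Martingale property: the cross term and the square combine to `-π k ^ 2 / s`, restoring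
        -- the potential.
        simp only [Finset.sum_add_distrib, Finset.sum_sub_distrib, ← Finset.mul_sum, hts, hmk]
        rcases eq_or_ne s 0 with h0 | h0
        · simp [h0]
        · push_cast
          field_simp
          ring

theorem AlmostFair.exists_value_le [Nonempty I] [Nonempty J] {A : K → Matrix I J ℝ}
    (hA : AlmostFair A) (p : stdSimplex ℝ K) :
    ∃ C : ℝ, 0 < C ∧ ∀ N : ℕ, 1 ≤ N → value A N p ≤ C * Real.sqrt N := by
  have : Nonempty K := by
    by_contra h
    rw [not_nonempty_iff] at h
    simpa using stdSimplex.sum_eq_one p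
  obtain ⟨c, hc⟩ := (Set.finite_range fun a : K × I × J => |A a.1 a.2.1 a.2.2|).bddAbove
  have hc' : ∀ k i j, |A k i j| ≤ max c 1 := fun k i j =>
    (hc ⟨(k, i, j), rfl⟩).trans (le_max_left _ _)
  have hc0 : 0 < max c 1 := lt_max_of_lt_right one_pos
  refine ⟨max c 1 * Fintype.card K, by positivity, fun N hN => ?_⟩
  have hN' : (0 : ℝ) < Real.sqrt N := Real.sqrt_pos.2 (by exact_mod_cast hN)
  obtain ⟨σ, hσ⟩ := (isGameValue_value A N p).1
  -- This `ε` balances `N * ε / 2` and `1 / (2 * ε)`, both equal to `√N / 2`.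
  obtain ⟨τ, hτ⟩ := hA.exists_priorPayoff_le (ε := 1 / Real.sqrt N) hc' (by positivity) N
    (π := p) (fun k => stdSimplex.zero_le p k) σ
  refine ((hσ τ).trans hτ).trans ?_
  rw [mul_assoc (max c 1) (Fintype.card K : ℝ)]
  refine mul_le_mul_of_nonneg_left ?_ hc0.le
  refine (Finset.sum_le_card_nsmul _ _ (Real.sqrt N) fun k _ => ?_).trans_eq
    (by rw [Finset.card_univ, nsmul_eq_mul])
  have hsq : (N : ℝ) = Real.sqrt N * Real.sqrt N := (Real.mul_self_sqrt N.cast_nonneg).symm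
  rw [stdSimplex.sum_eq_one]
  have h1 : (1 - p k ^ 2 / 1) / (2 * (1 / Real.sqrt N)) ≤ 1 / (2 * (1 / Real.sqrt N)) := by
    gcongr
    have := sq_nonneg (p k)
    linarith
  have h2 : (N : ℝ) * (1 / Real.sqrt N / 2) * 1 = Real.sqrt N / 2 := by
    nth_rw 1 [hsq]
    field_simp
  have h3 : 1 / (2 * (1 / Real.sqrt N)) = Real.sqrt N / 2 := by field_simp
  linarith

/-! ### Lower bound -/

/-- The informed player can guarantee the payoff `v` for the (not normalized) prior `π`. -/
def Guarantees (A : K → Matrix I J ℝ) (N : ℕ) (π : K → ℝ) (v : ℝ) : Prop :=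
  ∃ σ : Strategy₁ I J K, ∀ τ : Strategy₂ I J, v ≤ priorPayoff A N π σ τ

theorem Guarantees.mono {A : K → Matrix I J ℝ} {N : ℕ} {π : K → ℝ} {v w : ℝ}
    (h : Guarantees A N π v) (hw : w ≤ v) : Guarantees A N π w :=
  h.imp fun _ hσ τ => hw.trans (hσ τ)

theorem Guarantees.smul {A : K → Matrix I J ℝ} {N : ℕ} {π : K → ℝ} {v c : ℝ} (hc : 0 ≤ c)
    (h : Guarantees A N π v) : Guarantees A N (c • π) (c * v) :=
  h.imp fun _ hσ τ => by
    rw [priorPayoff_smul]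
    exact mul_le_mul_of_nonneg_left (hσ τ) hc

theorem Guarantees.add [Nonempty I] {A : K → Matrix I J ℝ} {N : ℕ} {π₁ π₂ : K → ℝ} {v₁ v₂ : ℝ}
    (hπ₁ : 0 ≤ π₁) (hπ₂ : 0 ≤ π₂) (h₁ : Guarantees A N π₁ v₁) (h₂ : Guarantees A N π₂ v₂) :
    Guarantees A N (π₁ + π₂) (v₁ + v₂) := by
  obtain ⟨σ₁, h₁⟩ := h₁
  obtain ⟨σ₂, h₂⟩ := h₂
  obtain ⟨σ, hσ⟩ := exists_priorPayoff_add A N hπ₁ hπ₂ σ₁ σ₂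
  exact ⟨σ, fun τ => by rw [hσ]; exact add_le_add (h₁ τ) (h₂ τ)⟩

/-- Any decomposition of the prior is realizable by play: in state `k`, choose `i` with probability
proportional to `μ i k`, so that `μ i` is the weight left after `i`. -/
theorem Guarantees.succ [Nonempty I] {A : K → Matrix I J ℝ} {N : ℕ} {μ : I → K → ℝ} {v : I → ℝ}
    {w : ℝ} (hμ : ∀ i, 0 ≤ μ i) (h : ∀ i, Guarantees A N (μ i) (v i))
    (hw : ∀ y : stdSimplex ℝ J, w ≤ ∑ i, ∑ j, y j * ∑ k, μ i k * A k i j) :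
    Guarantees A (N + 1) (∑ i, μ i) (w + ∑ i, v i) := by
  choose σ hσ using h
  choose x hx using fun k => exists_stdSimplex_mul_eq (c := (∑ i, μ i) k)
    (w := fun i => μ i k) (fun i => hμ i k) (Finset.sum_apply _ _ _).symm
  refine ⟨branch x fun a => σ a.1, fun τ => ?_⟩
  simp only [priorPayoff_succ, branch_nil, tail_branch, hx, mul_add, Finset.sum_add_distrib]
  refine add_le_add (hw _) (Finset.sum_le_sum fun i _ => ?_)
  calc v i = ∑ j, τ [] j * v i := by rw [← Finset.sum_mul, stdSimplex.sum_eq_one, one_mul]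
    _ ≤ _ := Finset.sum_le_sum fun j _ =>
      mul_le_mul_of_nonneg_left (hσ i _) (stdSimplex.zero_le _ _)

/-- Playing an optimal action of the average game independently of the state reveals nothing, so the
prior is only rescaled. -/
theorem AlmostFair.guarantees_zero [Nonempty I] [Nonempty J] [Nonempty K]
    {A : K → Matrix I J ℝ} (hA : AlmostFair A) (N : ℕ) {π : K → ℝ} (hπ : 0 ≤ π) :
    Guarantees A N π 0 := by
  induction N generalizing π with
  | zero => exact ⟨fun _ _ => Classical.arbitrary _, by simp⟩
  | succ N ih =>
    obtain ⟨x, hx⟩ := hA.exists_nonneg hπ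
    have hμ : ∀ i, 0 ≤ x i • π := fun i => smul_nonneg (stdSimplex.zero_le x i) hπ
    have := Guarantees.succ (w := 0) hμ (fun i => ih (hμ i)) fun y => by
      simpa only [Pi.smul_apply, smul_eq_mul, mul_comm (x _)] using hx y
    simpa [← Finset.sum_smul, stdSimplex.sum_eq_one] using this

/-- Player 1 runs a state-dependent lottery inducing `q₁` or `q₂` and plays `x₁` or `x₂`. Player 2
sees only the action, but by `Guarantees.add` the continuation is worth at least the mixture of `v₁`
and `v₂`. -/
theorem Guarantees.split [Nonempty I] {A : K → Matrix I J ℝ} {N : ℕ} {q₁ q₂ : stdSimplex ℝ K}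
    {x₁ x₂ : stdSimplex ℝ I} {v₁ v₂ w : ℝ}
    (h₁ : Guarantees A N q₁ v₁) (h₂ : Guarantees A N q₂ v₂)
    (hw : ∀ y : stdSimplex ℝ J, w ≤ 1 / 2 * mixedPayoff (avgMatrix A q₁) x₁ y +
      1 / 2 * mixedPayoff (avgMatrix A q₂) x₂ y) :
    Guarantees A (N + 1) ((1 / 2 : ℝ) • (q₁ : K → ℝ) + (1 / 2 : ℝ) • (q₂ : K → ℝ))
      (w + (1 / 2 * v₁ + 1 / 2 * v₂)) := by
  have hx₁ : ∀ i, 0 ≤ x₁ i / 2 := fun i => div_nonneg (stdSimplex.zero_le _ _) two_pos.le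
  have hx₂ : ∀ i, 0 ≤ x₂ i / 2 := fun i => div_nonneg (stdSimplex.zero_le _ _) two_pos.le
  have hq₁ : (0 : K → ℝ) ≤ q₁ := fun k => stdSimplex.zero_le q₁ k
  have hq₂ : (0 : K → ℝ) ≤ q₂ := fun k => stdSimplex.zero_le q₂ k
  have h := Guarantees.succ (w := w)
    (fun i => add_nonneg (smul_nonneg (hx₁ i) hq₁) (smul_nonneg (hx₂ i) hq₂))
    (fun i => (h₁.smul (hx₁ i)).add (smul_nonneg (hx₁ i) hq₁) (smul_nonneg (hx₂ i) hq₂)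
      (h₂.smul (hx₂ i))) fun y => by
        refine (hw y).trans (le_of_eq ?_)
        simp only [mixedPayoff_avgMatrix, Finset.mul_sum, ← Finset.sum_add_distrib,
          Pi.add_apply, Pi.smul_apply, smul_eq_mul]
        exact Finset.sum_congr rfl fun i _ => Finset.sum_congr rfl fun j _ =>
          Finset.sum_congr rfl fun k _ => by ring
  simpa only [Finset.sum_add_distrib, ← Finset.sum_smul, ← Finset.sum_mul, ← Finset.sum_div,
    stdSimplex.sum_eq_one] using h

theorem beliefPayoff_equalSplit (A : K → Matrix I J ℝ) (q₁ q₂ : stdSimplex ℝ K)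
    (x : BeliefStrategy I K) (y : stdSimplex ℝ J) :
    beliefPayoff A (equalSplit q₁ q₂) x y =
      1 / 2 * mixedPayoff (avgMatrix A q₁) (x.1 q₁) y +
        1 / 2 * mixedPayoff (avgMatrix A q₂) (x.1 q₂) y := by
  have hint : ∀ q : stdSimplex ℝ K, Integrable
      (fun q => mixedPayoff (avgMatrix A q) (x.1 q) y) ((1 / 2 : ENNReal) • Measure.dirac q) :=
    fun q => (integrable_dirac (by simp)).smul_measure (by simp)
  rw [beliefPayoff, equalSplit, integral_add_measure (hint _) (hint _)]
  simp only [integral_smul_measure, integral_dirac]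
  simp

theorem exists_le_of_lt_beliefValue [Nonempty I] [Nonempty J] {A : K → Matrix I J ℝ}
    {q₁ q₂ : stdSimplex ℝ K} {w : ℝ} (hw : w < beliefValue A (equalSplit q₁ q₂)) :
    ∃ x₁ x₂ : stdSimplex ℝ I, ∀ y : stdSimplex ℝ J,
      w ≤ 1 / 2 * mixedPayoff (avgMatrix A q₁) x₁ y +
        1 / 2 * mixedPayoff (avgMatrix A q₂) x₂ y := by
  have : Nonempty (BeliefStrategy I K) := ⟨⟨fun _ => Classical.arbitrary _, measurable_const⟩⟩
  obtain ⟨x, hx⟩ := exists_lt_of_lt_ciSup hw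
  refine ⟨x.1 q₁, x.1 q₂, fun y => ?_⟩
  rw [← beliefPayoff_equalSplit]
  refine hx.le.trans (ciInf_le (IsCompact.bddBelow (isCompact_range ?_)) y)
  simp only [beliefPayoff_equalSplit]
  exact (continuous_const.mul (continuous_mixedPayoff_right _ _)).add
    (continuous_const.mul (continuous_mixedPayoff_right _ _))

/-- Inductive step of the random walk: with `b = α (1 - α)` and step `δ = b / √(n + 1)`, the average
of `b` after moving by `±δ` is `b - δ²`, while the stage earns `2 δ` in units of `C / 2`. -/
theorem sqrt_succ_mul_le (n : ℕ) {b : ℝ} (hb0 : 0 ≤ b) (hb1 : b ≤ 1) :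
    Real.sqrt (n + 1 : ℕ) * b ≤ Real.sqrt n * (b - (b / Real.sqrt (n + 1 : ℕ)) ^ 2) +
      2 * (b / Real.sqrt (n + 1 : ℕ)) := by
  set q := Real.sqrt n
  set r := Real.sqrt (n + 1 : ℕ)
  have hq0 : 0 ≤ q := Real.sqrt_nonneg _
  have hr0 : 0 < r := Real.sqrt_pos.2 (by positivity)
  have hqr : q ≤ r := Real.sqrt_le_sqrt (by push_cast; linarith)
  have hq2 : q * q = n := Real.mul_self_sqrt n.cast_nonneg
  have hr2 : r * r = n + 1 := by
    rw [Real.mul_self_sqrt (by positivity)]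
    push_cast
    rfl
  have key : r * r * (r - q) + q * b ≤ 2 * r := by
    have h1 : r * (r - q) ≤ 1 := by nlinarith
    nlinarith [mul_le_mul_of_nonneg_left h1 hr0.le, mul_le_mul_of_nonneg_left hb1 hq0]
  have : q * (b - (b / r) ^ 2) + 2 * (b / r) - r * b =
      b / r ^ 2 * (2 * r - (r * r * (r - q) + q * b)) := by
    field_simp
    ring
  have h2 : 0 ≤ b / r ^ 2 * (2 * r - (r * r * (r - q) + q * b)) :=
    mul_nonneg (by positivity) (sub_nonneg.2 key)
  linarith

theorem segmentPoint_apply (p' p'' : stdSimplex ℝ K) (α : unitInterval) (k : K) :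
    segmentPoint p' p'' α k = α * p' k + (1 - α) * p'' k := rfl

/-- Revealing information along a random walk on the segment `[p', p'']` with steps of order
`1 / √N` yields a payoff of order `√N`. -/
theorem AlmostFair.guarantees_segmentPoint [Nonempty I] [Nonempty J] [Nonempty K]
    {A : K → Matrix I J ℝ} (hA : AlmostFair A) {p' p'' : stdSimplex ℝ K} {C : ℝ} (hC : 0 < C)
    (h : ∀ α₁ α₂ : unitInterval, C * |(α₁ : ℝ) - (α₂ : ℝ)| ≤
      beliefValue A (equalSplit (segmentPoint p' p'' α₁) (segmentPoint p' p'' α₂)))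
    (n : ℕ) (α : unitInterval) :
    Guarantees A n (segmentPoint p' p'' α) (C / 2 * (Real.sqrt n * (α * (1 - α)))) := by
  have hpos : ∀ q : stdSimplex ℝ K, (0 : K → ℝ) ≤ q := fun q k => stdSimplex.zero_le q k
  induction n generalizing α with
  | zero => simpa using hA.guarantees_zero 0 (hpos _)
  | succ n ih =>
    obtain ⟨a, ha0, ha1⟩ := α
    set b := a * (1 - a) with hb
    have hb0 : 0 ≤ b := mul_nonneg ha0 (sub_nonneg.2 ha1)
    rcases hb0.eq_or_lt with h0 | hbpos
    · simpa only [← hb, ← h0, mul_zero] using hA.guarantees_zero (n + 1) (hpos _)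
    have hr1 : 1 ≤ Real.sqrt (n + 1 : ℕ) := by
      rw [Real.one_le_sqrt]
      push_cast
      linarith [n.cast_nonneg (α := ℝ)]
    set r := Real.sqrt (n + 1 : ℕ)
    have hrpos : 0 < r := one_pos.trans_le hr1
    set δ := b / r with hδ
    have hδpos : 0 < δ := div_pos hbpos hrpos
    have hδb : δ ≤ b := div_le_self hb0 hr1
    -- `δ ≤ a (1 - a)` keeps both endpoints of the step in `[0, 1]`.
    have hδa : δ ≤ a := by nlinarith
    have hδa' : δ ≤ 1 - a := by nlinarith
    set α₁ : unitInterval := ⟨a + δ, by linarith, by linarith⟩ with hα₁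
    set α₂ : unitInterval := ⟨a - δ, by linarith, by linarith⟩ with hα₂
    -- The hypothesis gives `2 * C * δ`; half is given up for a strict inequality, so that a
    -- strategy below the supremum can be chosen.
    have hlt : C * δ < beliefValue A
        (equalSplit (segmentPoint p' p'' α₁) (segmentPoint p' p'' α₂)) := by
      refine lt_of_lt_of_le ?_ (h α₁ α₂)
      have : (α₁ : ℝ) - (α₂ : ℝ) = 2 * δ := by simp only [hα₁, hα₂]; ring
      rw [this, abs_of_pos (by linarith)]
      nlinarith
    obtain ⟨x₁, x₂, hx⟩ := exists_le_of_lt_beliefValue hlt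
    have hmid : (1 / 2 : ℝ) • (segmentPoint p' p'' α₁ : K → ℝ) +
        (1 / 2 : ℝ) • (segmentPoint p' p'' α₂ : K → ℝ) =
        segmentPoint p' p'' ⟨a, ha0, ha1⟩ := by
      funext k
      simp only [Pi.add_apply, Pi.smul_apply, smul_eq_mul, segmentPoint_apply, hα₁, hα₂]
      ring
    have := (ih α₁).split (ih α₂) hx
    rw [hmid] at this
    refine this.mono ?_
    have hb1 : b ≤ 1 := by nlinarith
    have hs := mul_le_mul_of_nonneg_left (sqrt_succ_mul_le n hb0 hb1) (half_pos hC).le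
    refine hs.trans (le_of_eq ?_)
    simp only [hα₁, hα₂, hb]
    ring

theorem AlmostFair.exists_le_value [Nonempty I] [Nonempty J] {A : K → Matrix I J ℝ}
    (hA : AlmostFair A) (hrev : HasSmallProfitableRevelations A) {p : stdSimplex ℝ K}
    (hp : ∀ k, 0 < p k) :
    ∃ C : ℝ, 0 < C ∧ ∀ N : ℕ, C * Real.sqrt N ≤ value A N p := by
  obtain ⟨p', p'', -, C, hC, h⟩ := hrev
  have : Nonempty K := by
    by_contra h
    rw [not_nonempty_iff] at h
    simpa using stdSimplex.sum_eq_one p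
  -- The least prior weight times a point of the simplex lies below `p` in every coordinate. At the
  -- midpoint `α (1 - α) = 1 / 4`, whence `C / 8`.
  obtain ⟨k₀, hk₀⟩ := Finite.exists_min p
  let α : unitInterval := ⟨1 / 2, by norm_num, by norm_num⟩
  have hm : (0 : K → ℝ) ≤ p k₀ • (segmentPoint p' p'' α : K → ℝ) :=
    smul_nonneg (hp k₀).le fun k => stdSimplex.zero_le (segmentPoint p' p'' α) k
  have hrest : (0 : K → ℝ) ≤ p - p k₀ • (segmentPoint p' p'' α : K → ℝ) := fun k =>
    sub_nonneg.2 <| (mul_le_of_le_one_right (hp k₀).le (stdSimplex.le_one _ k)).trans (hk₀ k)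
  have hk := hp k₀
  refine ⟨p k₀ * (C / 8), by positivity, fun N => ?_⟩
  obtain ⟨σ, hσ⟩ := ((hA.guarantees_segmentPoint hC h N α).smul hk.le).add hm hrest
    (hA.guarantees_zero N hrest)
  obtain ⟨τ, hτ⟩ := (isGameValue_value A N p).2
  rw [add_sub_cancel] at hσ
  refine le_trans (le_of_eq ?_) ((hσ τ).trans (hτ σ))
  simp only [α]
  ring

end RepeatedGame

theorem mainTheorem4 {I J K : Type*} [Fintype I] [Fintype J] [Fintype K] [Nonempty I] [Nonempty J]
    (A : K → Matrix I J ℝ) (hfair : RepeatedGame.AlmostFair A)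
    (hrev : RepeatedGame.HasSmallProfitableRevelations A)
    (p : stdSimplex ℝ K) (hp : ∀ k, 0 < p k) :
    (∀ N : ℕ, IsGameValue (RepeatedGame.totalPayoff A N p) (RepeatedGame.value A N p)) ∧
    ∃ C₁ C₂ : ℝ, 0 < C₁ ∧ 0 < C₂ ∧ ∀ N : ℕ, 1 ≤ N →
      C₁ * Real.sqrt N ≤ RepeatedGame.value A N p ∧
      RepeatedGame.value A N p ≤ C₂ * Real.sqrt N := by
  obtain ⟨C₁, hC₁, h₁⟩ := hfair.exists_le_value hrev hp
  obtain ⟨C₂, hC₂, h₂⟩ := hfair.exists_value_le p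
  exact ⟨fun N => RepeatedGame.isGameValue_value A N p,
    C₁, C₂, hC₁, hC₂, fun N hN => ⟨h₁ N, h₂ N hN⟩⟩
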